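/- Let $n\ge 2$ and let $(M,g)$ be an $n$-dimensional Lorentzian manifold, i.e. a smooth connected paracompact Hausdorff manifold with a smooth symmetric $(0,2)$-tensor field $g$ of signature $(-,+,\dots,+)$. Let $\nabla$ be its Levi-Civita connection, $R(X,Y)Z=\nabla_X\nabla_YZ-\nabla_Y\nabla_XZ-\nabla_{[X,Y]}Z$ its curvature tensor and $S(Y,Z)=\operatorname{tr}(X\mapsto R(X,Y)Z)$ its Ricci tensor. Suppose that $(M,g)$ is an $(LCS)_n$-manifold with structure $(\xi,\eta,\phi,\alpha)$. That is, $\xi$ is a smooth vector field with $g(\xi,\xi)=-1$; $\eta$ is the 1-form $\eta(X)=g(X,\xi)$; $\alpha$ is a nowhere vanishing smooth function; $\xi$ is concircular with scalar $\alpha$, i.e. there is a closed 1-form $\omega$ such that $$(\nabla_X\eta)(Y)=\alpha\{g(X,Y)+\omega(X)\eta(Y)\}$$ for all vector fields $X,Y$; moreover $$X(\alpha)=\rho\,\eta(X)\ \text{ for all } X,\qquad\text{where } \rho=-\xi(\alpha);$$ and $\phi X=\frac1\alpha\nabla_X\xi$. Put $\beta=-\xi(\rho)$. Suppose further that $(M,g)$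 is semi-generalized Ricci recurrent, i.e. there are vector fields $\rho_1,\rho_2$ such that, with $A(X)=g(X,\rho_1)$ and $B(X)=g(X,\rho_2)$, $$(\nabla_XS)(Y,Z)=A(X)S(Y,Z)+nB(X)g(Y,Z)$$ for all vector fields $X,Y,Z$. Then $$S=(n-1)(\alpha^2-\rho)\,g .$$ Moreover, $(M,g)$ is Einstein, i.e. $S=c\,g$ for some constant $c\in\mathbb R$, if and only if $\beta=2\alpha\rho$ on $M$. -/

import Mathlib

open scoped Manifold ContDiff Bundle

noncomputable section

namespace LCS

/-- The model space `ℝⁿ`. -/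
abbrev Model (n : ℕ) : Type := EuclideanSpace ℝ (Fin n)

/-- The tangent space at `x` of a manifold modelled on `ℝⁿ` (without boundary). -/
abbrev Tan (n : ℕ) {M : Type*} [TopologicalSpace M] [ChartedSpace (Model n) M] (x : M) : Type :=
  TangentSpace 𝓘(ℝ, Model n) x

/-- The connections (covariant derivatives) on the tangent bundle. `cov Y x v` is `∇_v Y` at `x`. -/
abbrev Connection (n : ℕ) (M : Type*) [TopologicalSpace M] [ChartedSpace (Model n) M]
    [IsManifold 𝓘(ℝ, Model n) ∞ M] : Type _ :=
  CovariantDerivative 𝓘(ℝ, Model n) (Model n) (fun x : M => Tan n x)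

section Defs

variable {n : ℕ} {M : Type*} [TopologicalSpace M] [ChartedSpace (Model n) M]

/-- The directional derivative `v(f)` of a scalar function `f` along the tangent vector `v`. -/
def dirDeriv (f : M → ℝ) (x : M) (v : Tan n x) : ℝ :=
  mvfderiv 𝓘(ℝ, Model n) f x v

variable [IsManifold 𝓘(ℝ, Model n) ∞ M]

/-- `X` is a smooth vector field. -/
def IsSmoothField (X : ∀ x : M, Tan n x) : Prop :=
  ContMDiff 𝓘(ℝ, Model n) (𝓘(ℝ, Model n).prod 𝓘(ℝ, Model n)) ∞
    (fun x => Bundle.TotalSpace.mk' (Model n) (E := fun x : M => Tan n x) x (X x))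

/-- `X` is differentiable at the point `x`, as a section of the tangent bundle. -/
def IsDiffFieldAt (X : ∀ x : M, Tan n x) (x : M) : Prop :=
  MDifferentiableAt 𝓘(ℝ, Model n) (𝓘(ℝ, Model n).prod 𝓘(ℝ, Model n))
    (fun x => Bundle.TotalSpace.mk' (Model n) (E := fun x : M => Tan n x) x (X x)) x

/-- `θ` is a smooth 1-form: a smooth section of the cotangent bundle. -/
def IsSmoothOneForm (θ : ∀ x : M, Tan n x →L[ℝ] ℝ) : Prop :=
  ContMDiff 𝓘(ℝ, Model n) (𝓘(ℝ, Model n).prod 𝓘(ℝ, Model n →L[ℝ] ℝ)) ∞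
    (fun x => Bundle.TotalSpace.mk' (Model n →L[ℝ] ℝ)
      (E := fun x : M => Tan n x →L[ℝ] ℝ) x (θ x))

/-- `θ` is closed: `dθ(X, Y) = X(θ(Y)) - Y(θ(X)) - θ([X, Y]) = 0`. -/
def IsClosedOneForm (θ : ∀ x : M, Tan n x →L[ℝ] ℝ) : Prop :=
  ∀ X Y : ∀ x : M, Tan n x, IsSmoothField X → IsSmoothField Y → ∀ x : M,
    dirDeriv (fun y => θ y (Y y)) x (X x) - dirDeriv (fun y => θ y (X y)) x (Y x)
      - θ x (VectorField.mlieBracket 𝓘(ℝ, Model n) X Y x) = 0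

variable (n M) in
/-- A Lorentzian metric on an `n`-dimensional manifold: a smooth symmetric (0,2) tensor field,
of signature `(-, +, …, +)` at every point. -/
structure LorentzMetric where
  /-- The bilinear form on each tangent space. -/
  val : ∀ x : M, Tan n x →L[ℝ] Tan n x →L[ℝ] ℝ
  symm : ∀ (x : M) (v w : Tan n x), val x v w = val x w v
  smooth : ContMDiff 𝓘(ℝ, Model n) (𝓘(ℝ, Model n).prod 𝓘(ℝ, Model n →L[ℝ] Model n →L[ℝ] ℝ)) ∞
    (fun x => Bundle.TotalSpace.mk' (Model n →L[ℝ] Model n →L[ℝ] ℝ)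
      (E := fun x : M => Tan n x →L[ℝ] Tan n x →L[ℝ] ℝ) x (val x))
  signature : ∀ x : M, ∃ e : Module.Basis (Fin n) ℝ (Tan n x), ∀ i j : Fin n,
    val x (e i) (e j) = if i = j then (if (i : ℕ) = 0 then -1 else 1) else 0

/-- `∇` is the Levi-Civita connection of `g`: the smooth connection on the tangent bundle
which is torsion-free and for which `g` is parallel. -/
structure IsLeviCivita (g : LorentzMetric n M) (cov : Connection n M) : Prop where
  smooth : CovariantDerivative.ContMDiffCovariantDerivative cov ∞
  torsion_free : ∀ (X Y : ∀ x : M, Tan n x) (x : M), IsDiffFieldAt X x → IsDiffFieldAt Y x →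
    cov Y x (X x) - cov X x (Y x) = VectorField.mlieBracket 𝓘(ℝ, Model n) X Y x
  metric : ∀ (Y Z : ∀ x : M, Tan n x) (x : M), IsDiffFieldAt Y x → IsDiffFieldAt Z x →
    ∀ v : Tan n x, dirDeriv (fun y => g.val y (Y y) (Z y)) x v
      = g.val x (cov Y x v) (Z x) + g.val x (Y x) (cov Z x v)

/-- `(∇_X η)(Y) = X(η(Y)) - η(∇_X Y)`. -/
def covDerivOneForm (cov : Connection n M) (η : ∀ x : M, Tan n x →L[ℝ] ℝ)
    (X Y : ∀ x : M, Tan n x) (x : M) : ℝ :=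
  dirDeriv (fun y => η y (Y y)) x (X x) - η x (cov Y x (X x))

/-- `(∇_X S)(Y, Z) = X(S(Y, Z)) - S(∇_X Y, Z) - S(Y, ∇_X Z)`. -/
def covDerivTwoTensor (cov : Connection n M) (S : ∀ x : M, Tan n x → Tan n x → ℝ)
    (X Y Z : ∀ x : M, Tan n x) (x : M) : ℝ :=
  dirDeriv (fun y => S y (Y y) (Z y)) x (X x)
    - S x (cov Y x (X x)) (Z x) - S x (Y x) (cov Z x (X x))

/-- The curvature operator on vector fields,
`R(X, Y)Z = ∇_X ∇_Y Z - ∇_Y ∇_X Z - ∇_{[X, Y]} Z`. -/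
def curvField (cov : Connection n M) (X Y Z : ∀ x : M, Tan n x) (x : M) : Tan n x :=
  cov (fun y => cov Z y (Y y)) x (X x) - cov (fun y => cov Z y (X y)) x (Y x)
    - cov Z x (VectorField.mlieBracket 𝓘(ℝ, Model n) X Y x)

/-- The curvature tensor at a point: `R(u, v)w` is computed by extending `u`, `v`, `w` to vector
fields that are smooth near `x` (the value does not depend on the extension). -/
def curv (cov : Connection n M) (x : M) (u v w : Tan n x) : Tan n x :=
  curvField cov (FiberBundle.extend (Model n) u) (FiberBundle.extend (Model n) v)
    (FiberBundle.extend (Model n) w) x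

/-- A basis of the tangent space at `x`: the standard basis of `ℝⁿ`, which is the vector space
underlying the tangent space. -/
def tanBasis (x : M) : Module.Basis (Fin n) ℝ (Tan n x) :=
  (EuclideanSpace.basisFun (Fin n) ℝ).toBasis

/-- The Ricci tensor `S(v, w) = trace (u ↦ R(u, v)w)`, the trace being written out in a basis. -/
def ricci (cov : Connection n M) (x : M) (v w : Tan n x) : ℝ :=
  ∑ i : Fin n, (tanBasis x).repr (curv cov x (tanBasis x i) v w) i

/-- `P` is a concircular vector field with scalar `α`: its metrically dual 1-form `A` satisfies
`(∇_X A)(Y) = α (g(X, Y) + θ(X) A(Y))` with `α` nowhere zero and `θ` a closed 1-form. -/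
def IsConcircular (g : LorentzMetric n M) (cov : Connection n M) (P : ∀ x : M, Tan n x)
    (α : M → ℝ) : Prop :=
  (∀ x, α x ≠ 0) ∧
  ∃ θ : ∀ x : M, Tan n x →L[ℝ] ℝ, IsSmoothOneForm θ ∧ IsClosedOneForm θ ∧
    ∀ X Y : ∀ x : M, Tan n x, IsSmoothField X → IsSmoothField Y → ∀ x : M,
      covDerivOneForm cov (fun y => g.val y (P y)) X Y x
        = α x * (g.val x (X x) (Y x) + θ x (X x) * g.val x (P x) (Y x))

/-- The scalar function `-(ξ f)`. -/
def negXi (ξ : ∀ x : M, Tan n x) (f : M → ℝ) (x : M) : ℝ :=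
  -dirDeriv f x (ξ x)

/-- A Lorentzian concircular structure `(ξ, η, φ, α)` on the Lorentzian manifold `(M, g)` with
Levi-Civita connection `∇`. Here `ρ = -(ξα)`. -/
structure IsLCSStructure (g : LorentzMetric n M) (cov : Connection n M) (ξ : ∀ x : M, Tan n x)
    (η : ∀ x : M, Tan n x →L[ℝ] ℝ) (φ : ∀ x : M, Tan n x → Tan n x) (α : M → ℝ) : Prop where
  smooth_xi : IsSmoothField ξ
  smooth_alpha : ContMDiff 𝓘(ℝ, Model n) 𝓘(ℝ, ℝ) ∞ α
  /-- `ξ` is a unit timelike vector field. -/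
  unit : ∀ x : M, g.val x (ξ x) (ξ x) = -1
  concircular : IsConcircular g cov ξ α
  eta_eq : ∀ (x : M) (v : Tan n x), η x v = g.val x v (ξ x)
  /-- `X(α) = ρ η(X)`. -/
  d_alpha : ∀ (x : M) (v : Tan n x), dirDeriv α x v = negXi ξ α x * η x v
  /-- `φ X = (1/α) ∇_X ξ`. -/
  phi_eq : ∀ (x : M) (v : Tan n x), φ x v = (1 / α x) • cov ξ x v

/-- `(M, g)` is semi-generalized Ricci recurrent:
`(∇_X S)(Y, Z) = A(X) S(Y, Z) + n B(X) g(Y, Z)` for some 1-forms `A = g(·, ρ₁)`, `B = g(·, ρ₂)`. -/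
def IsSemiGeneralizedRicciRecurrent (g : LorentzMetric n M) (cov : Connection n M) : Prop :=
  ∃ ρ₁ ρ₂ : ∀ x : M, Tan n x, IsSmoothField ρ₁ ∧ IsSmoothField ρ₂ ∧
    ∀ X Y Z : ∀ x : M, Tan n x, IsSmoothField X → IsSmoothField Y → IsSmoothField Z → ∀ x : M,
      covDerivTwoTensor cov (ricci cov) X Y Z x
        = g.val x (X x) (ρ₁ x) * ricci cov x (Y x) (Z x)
          + n * g.val x (X x) (ρ₂ x) * g.val x (Y x) (Z x)

/-- `(M, g)` is Einstein: `S = c g` with a constant `c`. -/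
def IsEinstein (g : LorentzMetric n M) (cov : Connection n M) : Prop :=
  ∃ c : ℝ, ∀ (x : M) (v w : Tan n x), ricci cov x v w = c * g.val x v w

end Defs

end LCS

end

/-!
Write `∇ξ` for the endomorphism `v ↦ ∇_v ξ`. Differentiating `g(ξ, ξ) = -1` identifies the 1-form of
the concircular field `ξ` with `η`, so `∇_v ξ = α (v + η(v) ξ)`. In particular `∇η` is symmetric and
`η` is closed, and then `dα = ρ η` forces `dρ = β η`. Differentiating `∇ξ` once more gives
`R(X, Y)ξ = (α² - ρ)(η(Y) X - η(X) Y)`, whose trace is `S(v, ξ) = (n - 1)(α² - ρ) η(v)`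
(`IsLCSStructure.ricci_xi`).

The covariant derivative `(∇_v S)(w, ξ)` can now be computed by the product rule, which produces
`-α S(w, v)` from `∇_v ξ`, and by the recurrence hypothesis, which produces a multiple of `η(w)`.
Comparison shows that `S - (n - 1)(α² - ρ) g` is a product `θ ⊗ η`. It is symmetric and vanishes
when contracted with `ξ`, hence it is zero (`IsLCSStructure.ricci_eq`). The metric is therefore
Einstein exactly when `α² - ρ` is constant, and `d(α² - ρ) = (2αρ - β) η`.

The argument rests on standard facts on the Levi-Civita curvature: skew-symmetry of `R(X, Y)`
with respect to `g`, the first Bianchi identity, and the symmetry of the Ricci tensor. The pointwise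
curvature is defined through local extensions of tangent vectors. These are cut off to globally
smooth fields, and the independence of the extension that is needed, together with linearity in the
last argument, follows from skew-symmetry and nondegeneracy of `g`.
-/

namespace LCS

/-! ### Vector fields acting on functions -/

section Calculus

open scoped Topology
open Filter VectorField

variable {n : ℕ} {M : Type*} [TopologicalSpace M] [ChartedSpace (Model n) M]

theorem dirDeriv_add {f h : M → ℝ} {x : M}
    (hf : MDifferentiableAt 𝓘(ℝ, Model n) 𝓘(ℝ, ℝ) f x)
    (hh : MDifferentiableAt 𝓘(ℝ, Model n) 𝓘(ℝ, ℝ) h x) (v : Tan n x) :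
    dirDeriv (fun y => f y + h y) x v = dirDeriv f x v + dirDeriv h x v := by
  simp only [dirDeriv]
  rw [mvfderiv_fun_add hf hh]; rfl

theorem dirDeriv_sub {f h : M → ℝ} {x : M}
    (hf : MDifferentiableAt 𝓘(ℝ, Model n) 𝓘(ℝ, ℝ) f x)
    (hh : MDifferentiableAt 𝓘(ℝ, Model n) 𝓘(ℝ, ℝ) h x) (v : Tan n x) :
    dirDeriv (fun y => f y - h y) x v = dirDeriv f x v - dirDeriv h x v := by
  simp only [dirDeriv]
  rw [mvfderiv_fun_sub hf hh]; rfl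

theorem dirDeriv_mul {f h : M → ℝ} {x : M}
    (hf : MDifferentiableAt 𝓘(ℝ, Model n) 𝓘(ℝ, ℝ) f x)
    (hh : MDifferentiableAt 𝓘(ℝ, Model n) 𝓘(ℝ, ℝ) h x) (v : Tan n x) :
    dirDeriv (fun y => f y * h y) x v = f x * dirDeriv h x v + h x * dirDeriv f x v := by
  simp only [dirDeriv]
  rw [mvfderiv_fun_mul hf hh]; rfl

theorem dirDeriv_const (c : ℝ) (x : M) (v : Tan n x) : dirDeriv (fun _ : M => c) x v = 0 := by
  unfold dirDeriv
  rw [mvfderiv_const]; rfl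

variable [IsManifold 𝓘(ℝ, Model n) ∞ M]

theorem IsSmoothField.isDiffFieldAt {X : ∀ x : M, Tan n x} (hX : IsSmoothField X) (x : M) :
    IsDiffFieldAt X x :=
  (hX x).mdifferentiableAt (by simp)

theorem IsSmoothField.smul {f : M → ℝ} {X : ∀ x : M, Tan n x}
    (hf : ContMDiff 𝓘(ℝ, Model n) 𝓘(ℝ, ℝ) ∞ f) (hX : IsSmoothField X) :
    IsSmoothField (f • X) :=
  ContMDiff.smul_section hf hX

theorem IsSmoothField.add {X Y : ∀ x : M, Tan n x} (hX : IsSmoothField X)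
    (hY : IsSmoothField Y) : IsSmoothField (X + Y) :=
  ContMDiff.add_section hX hY

theorem IsSmoothField.mlieBracket {X Y : ∀ x : M, Tan n x} (hX : IsSmoothField X)
    (hY : IsSmoothField Y) : IsSmoothField (mlieBracket 𝓘(ℝ, Model n) X Y) := by
  have : IsManifold 𝓘(ℝ, Model n) ((((⊤ : ℕ∞) : ℕ∞ω)) + 1) M := by
    simpa using (inferInstance : IsManifold 𝓘(ℝ, Model n) ∞ M)
  have : IsManifold 𝓘(ℝ, Model n) (minSmoothness ℝ 2) M := by
    rw [minSmoothness_of_isRCLikeNormedField]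
    exact IsManifold.of_le (n := ∞) (WithTop.coe_le_coe.2 le_top)
  exact ContDiff.mlieBracket_vectorField (m := ⊤) (n := ⊤) hX hY (by simp)

/-- The derivative of a smooth function along a smooth vector field is smooth. -/
theorem contMDiff_dirDeriv {f : M → ℝ} {X : ∀ x : M, Tan n x}
    (hf : ContMDiff 𝓘(ℝ, Model n) 𝓘(ℝ, ℝ) ∞ f) (hX : IsSmoothField X) :
    ContMDiff 𝓘(ℝ, Model n) 𝓘(ℝ, ℝ) ∞ (fun x => dirDeriv f x (X x)) := by
  have h1 := hf.contMDiff_tangentMap (m := ∞) (by simp)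
  exact (contMDiff_snd_tangentBundle_modelSpace ℝ 𝓘(ℝ, ℝ)).comp (h1.comp hX)

theorem mlieBracket_smul {X Y : ∀ x : M, Tan n x} {f : M → ℝ} {x : M}
    (hf : ContMDiff 𝓘(ℝ, Model n) 𝓘(ℝ, ℝ) ∞ f) (hY : IsSmoothField Y) :
    mlieBracket 𝓘(ℝ, Model n) X (f • Y) x
      = dirDeriv f x (X x) • Y x + f x • mlieBracket 𝓘(ℝ, Model n) X Y x :=
  mlieBracket_smul_right (hf.mdifferentiable (by simp) x) (hY.isDiffFieldAt x)

theorem jacobi {X Y Z : ∀ x : M, Tan n x} (hX : IsSmoothField X) (hY : IsSmoothField Y)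
    (hZ : IsSmoothField Z) :
    mlieBracket 𝓘(ℝ, Model n) X (mlieBracket 𝓘(ℝ, Model n) Y Z)
      = mlieBracket 𝓘(ℝ, Model n) (mlieBracket 𝓘(ℝ, Model n) X Y) Z
        + mlieBracket 𝓘(ℝ, Model n) Y (mlieBracket 𝓘(ℝ, Model n) X Z) := by
  have : IsManifold 𝓘(ℝ, Model n) (minSmoothness ℝ 3) M := by
    rw [minSmoothness_of_isRCLikeNormedField]
    exact IsManifold.of_le (n := ∞) (WithTop.coe_le_coe.2 le_top)
  have hle : minSmoothness ℝ 2 ≤ ∞ := by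
    rw [minSmoothness_of_isRCLikeNormedField]
    exact WithTop.coe_le_coe.2 le_top
  exact leibniz_identity_mlieBracket (hX.of_le hle) (hY.of_le hle) (hZ.of_le hle)

section Extension

variable [T2Space M]

theorem exists_smooth_eventuallyEq_extend {x : M} (v : Tan n x) :
    ∃ V : ∀ y : M, Tan n y, IsSmoothField V ∧
      V =ᶠ[𝓝 x] FiberBundle.extend (Model n) (E := fun y : M => Tan n y) v := by
  obtain ⟨s, hs, hsv⟩ := FiberBundle.exists_contMDiffOn_extend (k := ∞)
    𝓘(ℝ, Model n) (Model n) (V := fun x : M => Tan n x) v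
  obtain ⟨ψ, hψ, -⟩ := (SmoothBumpFunction.nhds_basis_support (I := 𝓘(ℝ, Model n))
    (interior_mem_nhds.2 hs)).mem_iff.1 (interior_mem_nhds.2 hs)
  refine ⟨(ψ : M → ℝ) • FiberBundle.extend (Model n) (E := fun y : M => Tan n y) v, ?_, ?_⟩
  · have := ContMDiffOn.smul_section_of_tsupport (V := fun x : M => Tan n x)
      (F := Model n) (I := 𝓘(ℝ, Model n)) (n := ∞) (u := interior s) (ψ := ψ)
      ψ.contMDiff.contMDiffOn isOpen_interior hψ (hsv.mono interior_subset)
    exact this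
  · filter_upwards [ψ.eventuallyEq_one] with y hy
    rw [Pi.smul_apply', hy]
    exact one_smul ℝ _

theorem exists_smooth_extension {x : M} (v : Tan n x) :
    ∃ V : ∀ y : M, Tan n y, IsSmoothField V ∧ V x = v := by
  obtain ⟨V, hV, h⟩ := exists_smooth_eventuallyEq_extend v
  exact ⟨V, hV, by rw [h.eq_of_nhds]; simp⟩

/-- Since `[X, f Z] = (X f) Z + f [X, Z]`, the identity can be read off from the Jacobi identity for
`[X, [Y, f Z]]`, with `Z` any field that does not vanish at the given point. -/
theorem dirDeriv_mlieBracket {X Y : ∀ x : M, Tan n x} (hX : IsSmoothField X)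
    (hY : IsSmoothField Y) {f : M → ℝ} (hf : ContMDiff 𝓘(ℝ, Model n) 𝓘(ℝ, ℝ) ∞ f) (x : M) :
    dirDeriv f x (mlieBracket 𝓘(ℝ, Model n) X Y x)
      = dirDeriv (fun y => dirDeriv f y (Y y)) x (X x)
        - dirDeriv (fun y => dirDeriv f y (X y)) x (Y x) := by
  by_cases h0 : ∀ v : Tan n x, v = 0
  · rw [h0 (mlieBracket _ _ _ _), h0 (X x), h0 (Y x)]
    simp [dirDeriv]
  push Not at h0
  obtain ⟨v, hv⟩ := h0
  obtain ⟨Z, hZ, rfl⟩ := exists_smooth_extension v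
  have hXf := contMDiff_dirDeriv hf hX
  have hYf := contMDiff_dirDeriv hf hY
  have e1 : ∀ W : ∀ y : M, Tan n y, mlieBracket 𝓘(ℝ, Model n) W (f • Z)
      = (fun y => dirDeriv f y (W y)) • Z + f • mlieBracket 𝓘(ℝ, Model n) W Z := by
    intro W; ext1 y; exact mlieBracket_smul hf hZ
  have key := congrFun (jacobi hX hY (hZ.smul hf)) x
  have hadd : ∀ {U A B : ∀ y : M, Tan n y}, IsSmoothField A → IsSmoothField B →
      mlieBracket 𝓘(ℝ, Model n) U (A + B) x
        = mlieBracket 𝓘(ℝ, Model n) U A x + mlieBracket 𝓘(ℝ, Model n) U B x :=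
    fun hA hB => mlieBracket_add_right (hA.isDiffFieldAt x) (hB.isDiffFieldAt x)
  rw [Pi.add_apply, e1, e1, e1, Pi.add_apply,
    hadd (hZ.smul hYf) ((hY.mlieBracket hZ).smul hf),
    hadd (hZ.smul hXf) ((hX.mlieBracket hZ).smul hf),
    mlieBracket_smul hYf hZ, mlieBracket_smul hXf hZ,
    mlieBracket_smul hf (hY.mlieBracket hZ), mlieBracket_smul hf (hX.mlieBracket hZ),
    jacobi hX hY hZ] at key
  simp only [Pi.add_apply, Pi.smul_apply'] at key
  have : (dirDeriv f x (mlieBracket 𝓘(ℝ, Model n) X Y x)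
      - (dirDeriv (fun y => dirDeriv f y (Y y)) x (X x)
        - dirDeriv (fun y => dirDeriv f y (X y)) x (Y x))) • Z x = 0 := by
    linear_combination (norm := module) -key
  rcases smul_eq_zero.1 this with h | h
  · linarith
  · exact absurd h hv

end Extension

/-- A smooth function with vanishing derivative on a connected manifold is constant. -/
theorem eq_of_dirDeriv_eq_zero [ConnectedSpace M] {f : M → ℝ}
    (hf : ContMDiff 𝓘(ℝ, Model n) 𝓘(ℝ, ℝ) ∞ f)
    (h : ∀ (x : M) (v : Tan n x), dirDeriv f x v = 0) (x y : M) : f x = f y := by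
  have hloc : IsLocallyConstant f := by
    rw [IsLocallyConstant.iff_eventually_eq]
    intro x
    set φ := extChartAt 𝓘(ℝ, Model n) x
    have hopen : IsOpen φ.target := isOpen_extChartAt_target x
    obtain ⟨r, hr, hball⟩ := Metric.isOpen_iff.1 hopen _ (mem_extChartAt_target x)
    have hmd : ∀ z ∈ Metric.ball (φ x) r,
        HasFDerivAt (f ∘ φ.symm) (0 : Model n →L[ℝ] ℝ) z := by
      intro z hz
      have h1 : MDifferentiableAt 𝓘(ℝ, Model n) 𝓘(ℝ, Model n) φ.symm z :=
        ((contMDiffOn_extChartAt_symm (n := ∞) x).contMDiffAt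
          (hopen.mem_nhds (hball hz))).mdifferentiableAt (by simp)
      have h2 : MDifferentiableAt 𝓘(ℝ, Model n) 𝓘(ℝ, ℝ) f (φ.symm z) :=
        hf.mdifferentiable (by simp) _
      have h3 := (h2.hasMFDerivAt.comp z h1.hasMFDerivAt).hasFDerivAt
      have h4 : (0 : Model n →L[ℝ] ℝ) = (mfderiv 𝓘(ℝ, Model n) 𝓘(ℝ, ℝ) f (φ.symm z)).comp
          (mfderiv 𝓘(ℝ, Model n) 𝓘(ℝ, Model n) φ.symm z) := by
        ext w
        exact (h (φ.symm z) _).symm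
      rw [h4]
      exact h3
    have hconst : ∀ z ∈ Metric.ball (φ x) r, (f ∘ φ.symm) z = (f ∘ φ.symm) (φ x) := by
      intro z hz
      refine (convex_ball (φ x) r).is_const_of_fderivWithin_eq_zero (𝕜 := ℝ)
        (fun w hw => (hmd w hw).differentiableAt.differentiableWithinAt) ?_ hz
        (Metric.mem_ball_self hr)
      intro w hw
      rw [fderivWithin_of_isOpen Metric.isOpen_ball hw, (hmd w hw).fderiv]
    have hnear : ∀ᶠ y in 𝓝 x, y ∈ φ.source ∧ φ y ∈ Metric.ball (φ x) r :=
      eventually_and.2 ⟨extChartAt_source_mem_nhds (I := 𝓘(ℝ, Model n)) x,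
        (continuousAt_extChartAt x).eventually (Metric.ball_mem_nhds _ hr)⟩
    filter_upwards [hnear] with y hy
    have := hconst _ hy.2
    simpa [φ.left_inv hy.1, φ.left_inv (mem_extChartAt_source x)] using this
  exact hloc.apply_eq_of_isPreconnected isPreconnected_univ (Set.mem_univ x) (Set.mem_univ y)

end Calculus

section Geometry

open scoped Topology
open Filter VectorField

variable {n : ℕ} {M : Type*} [TopologicalSpace M] [ChartedSpace (Model n) M]
  [IsManifold 𝓘(ℝ, Model n) ∞ M]

/-! ### Lorentzian scalar products -/

section Metric

variable (g : LorentzMetric n M)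

theorem LorentzMetric.contMDiff_apply {X Y : ∀ x : M, Tan n x} (hX : IsSmoothField X)
    (hY : IsSmoothField Y) :
    ContMDiff 𝓘(ℝ, Model n) 𝓘(ℝ, ℝ) ∞ (fun x => g.val x (X x) (Y x)) := by
  have h := ContMDiff.clm_bundle_apply₂ (F₁ := Model n) (F₂ := Model n) (F₃ := ℝ)
    (E₁ := fun x : M => Tan n x) (E₂ := fun x : M => Tan n x) (E₃ := fun _ : M => ℝ)
    (b := fun x : M => x) (n := ∞) (IM := 𝓘(ℝ, Model n)) (IB := 𝓘(ℝ, Model n))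
    (ψ := g.val) (v := X) (w := Y) g.smooth hX hY
  intro x
  exact (Bundle.contMDiffAt_section (x)).1 (h x)

theorem LorentzMetric.eq_zero_of_forall {x : M} {v : Tan n x}
    (h : ∀ w, g.val x v w = 0) : v = 0 := by
  obtain ⟨e, he⟩ := g.signature x
  rw [← e.sum_repr v]
  refine Finset.sum_eq_zero fun j _ => ?_
  have hj := h (e j)
  rw [← e.sum_repr v, map_sum, sum_apply, Finset.sum_eq_single j] at hj
  · rw [map_smul, smul_apply, he, if_pos rfl, smul_eq_mul] at hj
    have : e.repr v j = 0 := by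
      rcases mul_eq_zero.1 hj with h | h
      · exact h
      · split_ifs at h <;> norm_num at h
    rw [this, zero_smul]
  · intro i _ hij
    rw [map_smul, smul_apply, he, if_neg hij, smul_zero]
  · simp

theorem LorentzMetric.eq_of_forall {x : M} {v v' : Tan n x}
    (h : ∀ w, g.val x v w = g.val x v' w) : v = v' := by
  rw [← sub_eq_zero]
  refine g.eq_zero_of_forall fun w => ?_
  rw [map_sub, sub_apply, h, sub_self]

/-- An operator that is skew-adjoint for a Lorentzian scalar product is traceless: in an
orthonormal basis its diagonal entries are `± g(L eᵢ, eᵢ) = 0`. -/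
theorem LorentzMetric.trace_eq_zero_of_skew {x : M} (L : Tan n x →ₗ[ℝ] Tan n x)
    (h : ∀ v, g.val x (L v) v = 0) : LinearMap.trace ℝ (Tan n x) L = 0 := by
  obtain ⟨e, he⟩ := g.signature x
  rw [LinearMap.trace_eq_matrix_trace ℝ e, Matrix.trace]
  refine Finset.sum_eq_zero fun j _ => ?_
  rw [Matrix.diag_apply, LinearMap.toMatrix_apply]
  have hj := h (e j)
  rw [← e.sum_repr (L (e j)), map_sum, sum_apply,
    Finset.sum_eq_single j] at hj
  · rw [map_smul, smul_apply, he, if_pos rfl, smul_eq_mul] at hj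
    rcases mul_eq_zero.1 hj with h | h
    · exact h
    · split_ifs at h <;> norm_num at h
  · intro i _ hij
    rw [map_smul, smul_apply, he, if_neg hij, smul_zero]
  · simp

end Metric

/-! ### Connections and curvature of vector fields -/

section Connection

variable (cov : Connection n M)

theorem cov_add {X Y : ∀ x : M, Tan n x} {x : M} (hX : IsSmoothField X) (hY : IsSmoothField Y)
    (v : Tan n x) : cov (X + Y) x v = cov X x v + cov Y x v := by
  rw [cov.isCovariantDerivativeOnUniv.add (hX.isDiffFieldAt x) (hY.isDiffFieldAt x)]
  rfl

theorem cov_smul {f : M → ℝ} {X : ∀ x : M, Tan n x} {x : M}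
    (hf : ContMDiff 𝓘(ℝ, Model n) 𝓘(ℝ, ℝ) ∞ f) (hX : IsSmoothField X) (v : Tan n x) :
    cov (f • X) x v = f x • cov X x v + dirDeriv f x v • X x := by
  rw [cov.isCovariantDerivativeOnUniv.leibniz (hX.isDiffFieldAt x)
    (hf.mdifferentiable (by simp) x)]
  rfl

theorem cov_congr {X Y : ∀ x : M, Tan n x} {x : M} (hY : IsDiffFieldAt Y x)
    (h : X =ᶠ[𝓝 x] Y) : cov X x = cov Y x := by
  refine cov.isCovariantDerivativeOnUniv.congr_of_eventuallyEq ?_ hY univ_mem h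
  refine MDifferentiableAt.congr_of_eventuallyEq hY ?_
  filter_upwards [h] with y hy
  rw [hy]

theorem isSmoothField_cov {cov : Connection n M}
    (hcov : CovariantDerivative.ContMDiffCovariantDerivative cov ∞)
    {X Y : ∀ x : M, Tan n x} (hX : IsSmoothField X) (hY : IsSmoothField Y) :
    IsSmoothField (fun x => cov Y x (X x)) := by
  have h := hcov.contMDiff.contMDiff (σ := Y) (by
    have : (∞ : ℕ∞ω) + 1 = ∞ := by simp
    rw [this]; exact hY.contMDiffOn)
  rw [contMDiffOn_univ] at h
  exact ContMDiff.clm_bundle_apply (F₁ := Model n) (F₂ := Model n)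
    (E₁ := fun x : M => Tan n x) (E₂ := fun x : M => Tan n x)
    (b := fun x : M => x) (n := ∞) (IM := 𝓘(ℝ, Model n)) (IB := 𝓘(ℝ, Model n))
    (ϕ := fun x => cov Y x) (v := X) h hX

theorem curvField_antisymm (X Y Z : ∀ x : M, Tan n x) (x : M) :
    curvField cov X Y Z x = -curvField cov Y X Z x := by
  unfold curvField
  rw [mlieBracket_swap_apply (V := X) (W := Y), map_neg]
  module

theorem curvField_congr {cov : Connection n M}
    (hcov : CovariantDerivative.ContMDiffCovariantDerivative cov ∞)
    {X Y Z X' Y' Z' : ∀ x : M, Tan n x} {x : M} (hX' : IsSmoothField X')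
    (hY' : IsSmoothField Y') (hZ' : IsSmoothField Z')
    (hX : X =ᶠ[𝓝 x] X') (hY : Y =ᶠ[𝓝 x] Y') (hZ : Z =ᶠ[𝓝 x] Z') :
    curvField cov X Y Z x = curvField cov X' Y' Z' x := by
  have aux : ∀ {A A' : ∀ x : M, Tan n x}, IsSmoothField A' → A =ᶠ[𝓝 x] A' →
      cov (fun y => cov Z y (A y)) x = cov (fun y => cov Z' y (A' y)) x := by
    intro A A' hA' hA
    refine cov_congr cov ((isSmoothField_cov hcov hA' hZ').isDiffFieldAt x) ?_
    filter_upwards [hA, hZ.eventually_nhds] with y hy hZy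
    rw [hy, cov_congr cov (hZ'.isDiffFieldAt y) hZy]
  unfold curvField
  rw [aux hX' hX, aux hY' hY, cov_congr cov (hZ'.isDiffFieldAt x) hZ,
    hX.mlieBracket_vectorField_eq hY, hX.eq_of_nhds, hY.eq_of_nhds]

section LeviCivita

variable {cov} {g : LorentzMetric n M} (hcov : IsLeviCivita g cov)
include hcov

theorem IsLeviCivita.isSmoothField_cov {X Y : ∀ x : M, Tan n x} (hX : IsSmoothField X)
    (hY : IsSmoothField Y) : IsSmoothField (fun x => cov Y x (X x)) :=
  LCS.isSmoothField_cov hcov.smooth hX hY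

theorem IsLeviCivita.dirDeriv_metric {Y Z : ∀ x : M, Tan n x} (hY : IsSmoothField Y)
    (hZ : IsSmoothField Z) (x : M) (v : Tan n x) :
    dirDeriv (fun y => g.val y (Y y) (Z y)) x v
      = g.val x (cov Y x v) (Z x) + g.val x (Y x) (cov Z x v) :=
  hcov.metric Y Z x (hY.isDiffFieldAt x) (hZ.isDiffFieldAt x) v

theorem IsLeviCivita.cov_sub_cov {X Y : ∀ x : M, Tan n x} (hX : IsSmoothField X)
    (hY : IsSmoothField Y) (x : M) :
    cov Y x (X x) - cov X x (Y x) = mlieBracket 𝓘(ℝ, Model n) X Y x :=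
  hcov.torsion_free X Y x (hX.isDiffFieldAt x) (hY.isDiffFieldAt x)

/-- Vanishing torsion turns the cyclic sum of curvatures into the cyclic sum of iterated brackets,
which is zero by the Jacobi identity. -/
theorem IsLeviCivita.bianchi {X Y Z : ∀ x : M, Tan n x} (hX : IsSmoothField X)
    (hY : IsSmoothField Y) (hZ : IsSmoothField Z) (x : M) :
    curvField cov X Y Z x + curvField cov Y Z X x + curvField cov Z X Y x = 0 := by
  have aux : ∀ {A B : ∀ x : M, Tan n x}, IsSmoothField A → IsSmoothField B → ∀ v : Tan n x,
      cov (fun y => cov B y (A y)) x v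
        = cov (fun y => cov A y (B y)) x v + cov (mlieBracket 𝓘(ℝ, Model n) A B) x v := by
    intro A B hA hB v
    rw [← cov_add cov (hcov.isSmoothField_cov hB hA) (hA.mlieBracket hB)]
    congr 2
    ext1 y
    rw [Pi.add_apply, ← hcov.cov_sub_cov hA hB y]
    abel
  have hJ := congrFun (jacobi hX hY hZ) x
  rw [Pi.add_apply, ← hcov.cov_sub_cov hX (hY.mlieBracket hZ),
    ← hcov.cov_sub_cov (hX.mlieBracket hY) hZ, ← hcov.cov_sub_cov hY (hX.mlieBracket hZ)] at hJ
  unfold curvField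
  rw [aux hY hZ, aux hX hZ, aux hX hY, mlieBracket_swap_apply (V := Z) (W := X), map_neg]
  linear_combination (norm := module) hJ

/-- This is `[X, Y] f = X (Y f) - Y (X f)` for `f = g(Z, W)`: the mixed first-order terms are
symmetric in `X` and `Y`, so they cancel. -/
theorem IsLeviCivita.metric_curvField_skew [T2Space M] {X Y Z W : ∀ x : M, Tan n x}
    (hX : IsSmoothField X) (hY : IsSmoothField Y) (hZ : IsSmoothField Z) (hW : IsSmoothField W)
    (x : M) :
    g.val x (curvField cov X Y Z x) (W x) = -g.val x (Z x) (curvField cov X Y W x) := by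
  have hb := dirDeriv_mlieBracket hX hY (g.contMDiff_apply hZ hW) x
  have second : ∀ {A B : ∀ x : M, Tan n x}, IsSmoothField A → IsSmoothField B →
      dirDeriv (fun y => dirDeriv (fun y => g.val y (Z y) (W y)) y (B y)) x (A x)
        = g.val x (cov (fun y => cov Z y (B y)) x (A x)) (W x)
          + g.val x (cov Z x (B x)) (cov W x (A x))
          + (g.val x (cov Z x (A x)) (cov W x (B x))
          + g.val x (Z x) (cov (fun y => cov W y (B y)) x (A x))) := by
    intro A B hA hB
    have hBZ := hcov.isSmoothField_cov hB hZ
    have hBW := hcov.isSmoothField_cov hB hW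
    simp_rw [hcov.dirDeriv_metric hZ hW]
    rw [dirDeriv_add ((g.contMDiff_apply hBZ hW).mdifferentiable (by simp) x)
      ((g.contMDiff_apply hZ hBW).mdifferentiable (by simp) x),
      hcov.dirDeriv_metric hBZ hW, hcov.dirDeriv_metric hZ hBW]
  rw [second hX hY, second hY hX, hcov.dirDeriv_metric hZ hW] at hb
  unfold curvField
  simp only [map_sub, sub_apply]
  linarith

end LeviCivita

end Connection

/-! ### The curvature and Ricci tensors at a point -/

section Curvature

variable [T2Space M]

/-- A globally smooth vector field with value `v` at `x`, agreeing near `x` with the local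
extension used in the definition of the curvature tensor. -/
noncomputable def smoothExtend {x : M} (v : Tan n x) : ∀ y : M, Tan n y :=
  (exists_smooth_eventuallyEq_extend v).choose

theorem isSmoothField_smoothExtend {x : M} (v : Tan n x) : IsSmoothField (smoothExtend v) :=
  (exists_smooth_eventuallyEq_extend v).choose_spec.1

theorem smoothExtend_eventuallyEq {x : M} (v : Tan n x) :
    smoothExtend v =ᶠ[𝓝 x] FiberBundle.extend (Model n) (E := fun y : M => Tan n y) v :=
  (exists_smooth_eventuallyEq_extend v).choose_spec.2

@[simp]
theorem smoothExtend_self {x : M} (v : Tan n x) : smoothExtend v x = v := by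
  rw [(smoothExtend_eventuallyEq v).eq_of_nhds]; simp

variable {cov : Connection n M} {g : LorentzMetric n M} (hcov : IsLeviCivita g cov)
include hcov

theorem IsLeviCivita.curv_eq (x : M) (u v w : Tan n x) :
    curv cov x u v w
      = curvField cov (smoothExtend u) (smoothExtend v) (smoothExtend w) x :=
  curvField_congr hcov.smooth (isSmoothField_smoothExtend u)
    (isSmoothField_smoothExtend v) (isSmoothField_smoothExtend w)
    (smoothExtend_eventuallyEq u).symm (smoothExtend_eventuallyEq v).symm
    (smoothExtend_eventuallyEq w).symm

theorem IsLeviCivita.metric_curv_skew (x : M) (u v w z : Tan n x) :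
    g.val x (curv cov x u v w) z = -g.val x w (curv cov x u v z) := by
  have h := hcov.metric_curvField_skew (isSmoothField_smoothExtend u)
    (isSmoothField_smoothExtend v) (isSmoothField_smoothExtend w)
    (isSmoothField_smoothExtend z) x
  rwa [← hcov.curv_eq, ← hcov.curv_eq, smoothExtend_self, smoothExtend_self] at h

/-- The curvature may be computed with any smooth extension of its last argument. Both sides have
the same scalar product with every `z`, as moving the operator to `z` leaves only the value of
the field at `x`. -/
theorem IsLeviCivita.curv_eq_curvField {Z : ∀ x : M, Tan n x} (hZ : IsSmoothField Z) (x : M)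
    (u v : Tan n x) :
    curv cov x u v (Z x) = curvField cov (smoothExtend u) (smoothExtend v) Z x := by
  refine g.eq_of_forall fun z => ?_
  have h := hcov.metric_curvField_skew (isSmoothField_smoothExtend u)
    (isSmoothField_smoothExtend v) hZ (isSmoothField_smoothExtend z) x
  rw [← hcov.curv_eq, smoothExtend_self] at h
  rw [h, hcov.metric_curv_skew]

/-- The curvature operator `R(u, v)` as a linear map. -/
noncomputable def IsLeviCivita.curvLinear (x : M) (u v : Tan n x) : Tan n x →ₗ[ℝ] Tan n x where
  toFun w := curv cov x u v w
  map_add' w w' := by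
    refine g.eq_of_forall fun z => ?_
    rw [map_add, add_apply]
    iterate 3 rw [hcov.metric_curv_skew]
    rw [map_add, add_apply]
    ring
  map_smul' c w := by
    refine g.eq_of_forall fun z => ?_
    rw [map_smul, smul_apply]
    iterate 2 rw [hcov.metric_curv_skew]
    rw [RingHom.id_apply, map_smul, smul_apply, smul_neg]

theorem IsLeviCivita.trace_curv (x : M) (u v : Tan n x) :
    ∑ i : Fin n, (tanBasis x).repr (curv cov x u v (tanBasis x i)) i = 0 := by
  have h : LinearMap.trace ℝ (Tan n x) (hcov.curvLinear x u v) = 0 := by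
    refine g.trace_eq_zero_of_skew _ fun w => ?_
    have := hcov.metric_curv_skew x u v w w
    rw [g.symm x w] at this
    change g.val x (curv cov x u v w) w = 0
    linarith
  rw [LinearMap.trace_eq_matrix_trace ℝ (tanBasis x), Matrix.trace] at h
  simp only [Matrix.diag_apply, LinearMap.toMatrix_apply] at h
  exact h

theorem IsLeviCivita.ricci_add_right (x : M) (u v w : Tan n x) :
    ricci cov x u (v + w) = ricci cov x u v + ricci cov x u w := by
  unfold ricci
  rw [← Finset.sum_add_distrib]
  refine Finset.sum_congr rfl fun i _ => ?_
  have h : curv cov x (tanBasis x i) u (v + w)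
      = curv cov x (tanBasis x i) u v + curv cov x (tanBasis x i) u w :=
    (hcov.curvLinear x (tanBasis x i) u).map_add v w
  rw [h, map_add, Finsupp.add_apply]

theorem IsLeviCivita.ricci_smul_right (x : M) (u v : Tan n x) (c : ℝ) :
    ricci cov x u (c • v) = c * ricci cov x u v := by
  unfold ricci
  rw [Finset.mul_sum]
  refine Finset.sum_congr rfl fun i _ => ?_
  have h : curv cov x (tanBasis x i) u (c • v) = c • curv cov x (tanBasis x i) u v :=
    (hcov.curvLinear x (tanBasis x i) u).map_smul c v
  rw [h, map_smul, Finsupp.smul_apply, smul_eq_mul]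

/-- By the Bianchi identity, `S(v, w) - S(w, v)` is minus the trace of `R(v, w)`, and `R(v, w)` is
skew-adjoint. -/
theorem IsLeviCivita.ricci_symm (x : M) (v w : Tan n x) :
    ricci cov x v w = ricci cov x w v := by
  rw [← sub_eq_zero, ← neg_eq_zero, ← hcov.trace_curv x v w]
  unfold ricci
  rw [← Finset.sum_sub_distrib, ← Finset.sum_neg_distrib]
  refine Finset.sum_congr rfl fun i _ => ?_
  have hB := hcov.bianchi (isSmoothField_smoothExtend (tanBasis x i))
    (isSmoothField_smoothExtend v) (isSmoothField_smoothExtend w) x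
  rw [curvField_antisymm cov (smoothExtend w), ← hcov.curv_eq, ← hcov.curv_eq,
    ← hcov.curv_eq] at hB
  have h : curv cov x v w (tanBasis x i)
      = -(curv cov x (tanBasis x i) v w - curv cov x (tanBasis x i) w v) := by
    linear_combination (norm := module) hB
  rw [h, map_neg, map_sub]
  rfl

end Curvature

end Geometry

/-! ### Lorentzian concircular structures -/

section Structure

open VectorField

variable {n : ℕ} {M : Type*} [TopologicalSpace M] [ChartedSpace (Model n) M]
  [IsManifold 𝓘(ℝ, Model n) ∞ M]
  {g : LorentzMetric n M} {cov : Connection n M} (hcov : IsLeviCivita g cov)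
  {ξ : ∀ x : M, Tan n x} {η : ∀ x : M, Tan n x →L[ℝ] ℝ}
  {φ : ∀ x : M, Tan n x → Tan n x} {α : M → ℝ}
  (hLCS : IsLCSStructure g cov ξ η φ α)

include hLCS

theorem IsLCSStructure.eta_xi (x : M) : η x (ξ x) = -1 := by
  rw [hLCS.eta_eq, hLCS.unit]

theorem IsLCSStructure.contMDiff_eta {Y : ∀ x : M, Tan n x} (hY : IsSmoothField Y) :
    ContMDiff 𝓘(ℝ, Model n) 𝓘(ℝ, ℝ) ∞ (fun x => η x (Y x)) := by
  simp_rw [hLCS.eta_eq]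
  exact g.contMDiff_apply hY hLCS.smooth_xi

theorem IsLCSStructure.contMDiff_rho :
    ContMDiff 𝓘(ℝ, Model n) 𝓘(ℝ, ℝ) ∞ (negXi ξ α) :=
  (contMDiff_dirDeriv hLCS.smooth_alpha hLCS.smooth_xi).neg

variable [T2Space M]

include hcov

theorem IsLCSStructure.cov_xi (x : M) (v : Tan n x) :
    cov ξ x v = α x • (v + η x v • ξ x) := by
  obtain ⟨hα, θ, -, -, hθ⟩ := hLCS.concircular
  have h1 : cov ξ x v = α x • (v + θ x v • ξ x) := by
    refine g.eq_of_forall fun w => ?_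
    have h := hθ (smoothExtend v) (smoothExtend w) (isSmoothField_smoothExtend v)
      (isSmoothField_smoothExtend w) x
    unfold covDerivOneForm at h
    rw [hcov.dirDeriv_metric hLCS.smooth_xi (isSmoothField_smoothExtend w)] at h
    simp only [smoothExtend_self] at h
    simp only [map_smul, map_add, add_apply, smul_apply, smul_eq_mul]
    linarith
  -- Differentiating `g(ξ, ξ) = -1` shows that the 1-form of the concircular field is `η`.
  have h2 := hcov.dirDeriv_metric hLCS.smooth_xi hLCS.smooth_xi x v
  simp_rw [hLCS.unit] at h2
  rw [dirDeriv_const, g.symm x (ξ x), h1] at h2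
  simp only [map_smul, map_add, add_apply, smul_apply, smul_eq_mul, hLCS.unit] at h2
  have h3 : α x * (g.val x v (ξ x) - θ x v) = 0 := by linarith
  have h4 : θ x v = η x v := by
    rw [hLCS.eta_eq]
    linarith [(mul_eq_zero.1 h3).resolve_left (hα x)]
  rw [h1, h4]

theorem IsLCSStructure.dirDeriv_eta {Y : ∀ x : M, Tan n x} (hY : IsSmoothField Y) (x : M)
    (v : Tan n x) :
    dirDeriv (fun y => η y (Y y)) x v
      = η x (cov Y x v) + α x * (g.val x v (Y x) + η x v * η x (Y x)) := by
  simp_rw [hLCS.eta_eq]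
  rw [hcov.dirDeriv_metric hY hLCS.smooth_xi, hLCS.cov_xi hcov]
  simp only [map_smul, map_add, smul_eq_mul, hLCS.eta_eq]
  rw [g.symm x (Y x) v]

theorem IsLCSStructure.eta_mlieBracket {X Y : ∀ x : M, Tan n x} (hX : IsSmoothField X)
    (hY : IsSmoothField Y) (x : M) :
    η x (mlieBracket 𝓘(ℝ, Model n) X Y x)
      = dirDeriv (fun y => η y (Y y)) x (X x) - dirDeriv (fun y => η y (X y)) x (Y x) := by
  rw [← hcov.cov_sub_cov hX hY, hLCS.dirDeriv_eta hcov hY, hLCS.dirDeriv_eta hcov hX, map_sub,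
    g.symm x (Y x)]
  ring

/-- The differential of `ρ = -(ξα)` is `β η` with `β = -(ξρ)`: as `dα = ρ η` and `η` is closed,
`dρ ∧ η = 0`, and it remains to contract with `ξ`. -/
theorem IsLCSStructure.d_rho (x : M) (v : Tan n x) :
    dirDeriv (negXi ξ α) x v = negXi ξ (negXi ξ α) x * η x v := by
  have hX := isSmoothField_smoothExtend v
  have hξ := hLCS.smooth_xi
  have h := dirDeriv_mlieBracket hX hξ hLCS.smooth_alpha x
  simp_rw [hLCS.d_alpha] at h
  have hρ := hLCS.contMDiff_rho.mdifferentiable (by simp) x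
  rw [dirDeriv_mul hρ ((hLCS.contMDiff_eta hξ).mdifferentiable (by simp) x),
    dirDeriv_mul hρ ((hLCS.contMDiff_eta hX).mdifferentiable (by simp) x),
    hLCS.eta_mlieBracket hcov hX hξ, hLCS.eta_xi] at h
  simp only [smoothExtend_self] at h
  change _ = -dirDeriv (negXi ξ α) x (ξ x) * _
  linarith

theorem IsLCSStructure.cov_cov_xi {Y : ∀ x : M, Tan n x} (hY : IsSmoothField Y) (x : M)
    (v : Tan n x) :
    cov (fun y => cov ξ y (Y y)) x v
      = α x • (cov Y x v + (η x (Y x) • (α x • (v + η x v • ξ x))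
          + dirDeriv (fun y => η y (Y y)) x v • ξ x))
        + (negXi ξ α x * η x v) • (Y x + η x (Y x) • ξ x) := by
  have hηY := hLCS.contMDiff_eta hY
  have hs := hLCS.smooth_xi.smul hηY
  have e : (fun y => cov ξ y (Y y)) = α • (Y + (fun y => η y (Y y)) • ξ) := by
    ext1 y
    exact hLCS.cov_xi hcov y (Y y)
  rw [e, cov_smul cov hLCS.smooth_alpha (hY.add hs), cov_add cov hY hs,
    cov_smul cov hηY hLCS.smooth_xi, hLCS.cov_xi hcov, hLCS.d_alpha]
  rfl

theorem IsLCSStructure.curvField_xi {X Y : ∀ x : M, Tan n x} (hX : IsSmoothField X)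
    (hY : IsSmoothField Y) (x : M) :
    curvField cov X Y ξ x
      = (α x ^ 2 - negXi ξ α x) • (η x (Y x) • X x - η x (X x) • Y x) := by
  unfold curvField
  rw [hLCS.cov_cov_xi hcov hY, hLCS.cov_cov_xi hcov hX, hLCS.cov_xi hcov,
    hLCS.eta_mlieBracket hcov hX hY, ← hcov.cov_sub_cov hX hY]
  module

theorem IsLCSStructure.ricci_xi (x : M) (v : Tan n x) :
    ricci cov x v (ξ x) = ((n : ℝ) - 1) * (α x ^ 2 - negXi ξ α x) * η x v := by
  unfold ricci
  have h : ∀ i : Fin n, (tanBasis x).repr (curv cov x (tanBasis x i) v (ξ x)) i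
      = (α x ^ 2 - negXi ξ α x)
        * (η x v - (tanBasis x).repr v i * η x (tanBasis x i)) := by
    intro i
    rw [hcov.curv_eq_curvField hLCS.smooth_xi,
      hLCS.curvField_xi hcov (isSmoothField_smoothExtend _) (isSmoothField_smoothExtend _)]
    simp only [smoothExtend_self, map_smul, map_sub, Finsupp.smul_apply, Finsupp.sub_apply,
      smul_eq_mul, Module.Basis.repr_self, Finsupp.single_eq_same]
    ring
  have hsum : ∑ i : Fin n, (tanBasis x).repr v i * η x (tanBasis x i) = η x v := by
    conv_rhs => rw [← (tanBasis x).sum_repr v, map_sum]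
    simp only [map_smul, smul_eq_mul]
  simp_rw [h]
  rw [← Finset.mul_sum, Finset.sum_sub_distrib, hsum]
  simp only [Finset.sum_const, Finset.card_univ, Fintype.card_fin, nsmul_eq_mul]
  ring

theorem IsLCSStructure.d_alpha_sq_sub_rho (x : M) (v : Tan n x) :
    dirDeriv (fun y => α y ^ 2 - negXi ξ α y) x v
      = (2 * α x * negXi ξ α x - negXi ξ (negXi ξ α) x) * η x v := by
  have hα := hLCS.smooth_alpha.mdifferentiable (by simp) x
  simp_rw [pow_two]
  rw [dirDeriv_sub (f := fun y => α y * α y) (hα.mul hα) (hLCS.contMDiff_rho.mdifferentiable (by simp) x),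
    dirDeriv_mul hα hα, hLCS.d_alpha, hLCS.d_rho hcov]
  ring

/-- Evaluating `(∇_v S)(w, ξ)` by the product rule and by the recurrence hypothesis shows that
`S - (n - 1)(α² - ρ) g` equals `θ ⊗ η` for some form `θ`. That tensor vanishes when one of its
arguments is `ξ`, so `θ = 0`. -/
theorem IsLCSStructure.ricci_eq (hrec : IsSemiGeneralizedRicciRecurrent g cov) (x : M)
    (v w : Tan n x) :
    ricci cov x v w = ((n : ℝ) - 1) * (α x ^ 2 - negXi ξ α x) * g.val x v w := by
  obtain ⟨ρ₁, ρ₂, -, -, h⟩ := hrec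
  have key : ∀ v w : Tan n x,
      ((n : ℝ) - 1) * ((2 * α x * negXi ξ α x - negXi ξ (negXi ξ α) x) * η x v * η x w
          + (α x ^ 2 - negXi ξ α x) * α x * g.val x v w) - α x * ricci cov x w v
        = (g.val x v (ρ₁ x) * (((n : ℝ) - 1) * (α x ^ 2 - negXi ξ α x))
          + n * g.val x v (ρ₂ x)) * η x w := by
    intro v w
    have hW := isSmoothField_smoothExtend w
    have hvw := h (smoothExtend v) (smoothExtend w) ξ (isSmoothField_smoothExtend v) hW
      hLCS.smooth_xi x
    have hf : ContMDiff 𝓘(ℝ, Model n) 𝓘(ℝ, ℝ) ∞ (fun y => α y ^ 2 - negXi ξ α y) :=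
      (hLCS.smooth_alpha.pow 2).sub hLCS.contMDiff_rho
    have hη := hLCS.contMDiff_eta hW
    unfold covDerivTwoTensor at hvw
    simp_rw [hLCS.ricci_xi hcov, mul_assoc] at hvw
    have hfη : ContMDiff 𝓘(ℝ, Model n) 𝓘(ℝ, ℝ) ∞
        (fun y => (α y ^ 2 - negXi ξ α y) * η y (smoothExtend w y)) := hf.mul hη
    rw [dirDeriv_mul mdifferentiableAt_const (hfη.mdifferentiable (by simp) x), dirDeriv_const,
      dirDeriv_mul (hf.mdifferentiable (by simp) x) (hη.mdifferentiable (by simp) x),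
      hLCS.d_alpha_sq_sub_rho hcov, hLCS.dirDeriv_eta hcov hW, hLCS.cov_xi hcov,
      hcov.ricci_smul_right, hcov.ricci_add_right, hcov.ricci_smul_right,
      hLCS.ricci_xi hcov, ← hLCS.eta_eq x (smoothExtend w x)] at hvw
    simp only [smoothExtend_self] at hvw
    linear_combination hvw
  have h1 := key w v
  have h2 := key w (ξ x)
  rw [hLCS.eta_xi, hcov.ricci_symm x (ξ x), hLCS.ricci_xi hcov, ← hLCS.eta_eq] at h2
  have h3 : α x * (ricci cov x v w
      - ((n : ℝ) - 1) * (α x ^ 2 - negXi ξ α x) * g.val x v w) = 0 := by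
    rw [g.symm x v w]
    linear_combination -h1 - η x v * h2
  linarith [(mul_eq_zero.1 h3).resolve_left (hLCS.concircular.1 x)]

end Structure

end LCS

/-! ### Ricci recurrence and the Einstein condition -/

/-- `ρ = -(ξα)` and `β = -(ξρ)`. -/
theorem theorem5p1 (n : ℕ) (hn : 2 ≤ n)
    (M : Type*) [TopologicalSpace M] [ChartedSpace (LCS.Model n) M]
    [IsManifold 𝓘(ℝ, LCS.Model n) ∞ M] [T2Space M] [ParacompactSpace M] [ConnectedSpace M]
    (g : LCS.LorentzMetric n M) (cov : LCS.Connection n M) (hcov : LCS.IsLeviCivita g cov)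
    (ξ : ∀ x : M, LCS.Tan n x) (η : ∀ x : M, LCS.Tan n x →L[ℝ] ℝ)
    (φ : ∀ x : M, LCS.Tan n x → LCS.Tan n x) (α ρ β : M → ℝ)
    (hLCS : LCS.IsLCSStructure g cov ξ η φ α)
    (hρ : ρ = LCS.negXi ξ α) (hβ : β = LCS.negXi ξ ρ)
    (hrec : LCS.IsSemiGeneralizedRicciRecurrent g cov) :
    (∀ (x : M) (v w : LCS.Tan n x),
      LCS.ricci cov x v w = ((n : ℝ) - 1) * (α x ^ 2 - ρ x) * g.val x v w) ∧
    (LCS.IsEinstein g cov ↔ ∀ x : M, β x = 2 * α x * ρ x) := by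
  subst hρ hβ
  have hS := hLCS.ricci_eq hcov hrec
  refine ⟨hS, ?_, ?_⟩
  · rintro ⟨c, hc⟩ x
    have hn1 : (n : ℝ) - 1 ≠ 0 := by
      have : (2 : ℝ) ≤ n := by exact_mod_cast hn
      linarith
    -- Comparing the two formulas for `S(ξ, ξ)` shows that `α² - ρ` is the constant `c / (n - 1)`.
    have hconst : (fun y => α y ^ 2 - LCS.negXi ξ α y) = fun _ => c / ((n : ℝ) - 1) := by
      ext1 y
      have h := (hS y (ξ y) (ξ y)).symm.trans (hc y (ξ y) (ξ y))
      rw [hLCS.unit] at h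
      rw [eq_div_iff hn1]
      linarith
    have h := hLCS.d_alpha_sq_sub_rho hcov x (ξ x)
    rw [hconst, LCS.dirDeriv_const, hLCS.eta_xi] at h
    linarith
  · intro h
    have hf : ContMDiff 𝓘(ℝ, LCS.Model n) 𝓘(ℝ, ℝ) ∞
        (fun y => α y ^ 2 - LCS.negXi ξ α y) :=
      (hLCS.smooth_alpha.pow 2).sub hLCS.contMDiff_rho
    have hconst := LCS.eq_of_dirDeriv_eq_zero hf fun x v => by
      rw [hLCS.d_alpha_sq_sub_rho hcov, h x, sub_self, zero_mul]
    obtain ⟨x₀⟩ := (inferInstance : Nonempty M)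
    refine ⟨((n : ℝ) - 1) * (α x₀ ^ 2 - LCS.negXi ξ α x₀), fun x v w => ?_⟩
    rw [hS, hconst x x₀]
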